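/- **Conventions.** Finite subsets of $\omega$ are ordered by $a\sqsubseteq b$ ($a$ is an initial segment of $b$ in the increasing enumeration); $\sqsubset$ means proper initial segment, also when $b$ is infinite. A *p-point* is a nonprincipal ultrafilter $\mathcal U$ on $\omega$ such that for every decreasing sequence $X_0\supseteq X_1\supseteq\cdots$ of members of $\mathcal U$ there is $Y\in\mathcal U$ with $Y\setminus X_n$ finite for all $n$. A *front* on $\omega$ is a set $B$ of finite subsets of $\omega$ such that no member of $B$ is a proper initial segment of another member, and every infinite $X\subseteq\omega$ has some $b\in B$ with $b\sqsubset X$. It is *flat-top* if $B\neq\{\emptyset\}$ and either $B=[\omega]^1$, or all members of $B$ have at least two elements and for each $b\in B$, with $a=b\setminus\{\max b\}$, we have $\{c\setminus a: c\in B,\ a\sqsubset c\}=\{\{l\}: l>\max a\}$. Let $\hat B$ (resp. $\hat B^-$) be the set of initial segments (resp. proper initial segments) of members of $B$. Given a sequence $\vec{\mathcal U}=(\mathcal U_c:c\in\hat B^-)$ of nonprincipal ultrafilters on $\omega$, a *$\vec{\mathcal U}$-tree* is a set $T\subseteq\hat B$ closed under initial segments, with $\emptyset\in T$ and $\{n: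 c\cup\{n\}\in T\}\in\mathcal U_c$ for every $c\in T\cap\hat B^-$. Let $[T]\subseteq B$ be the set of its maximal branches (identified with its $\sqsubseteq$-maximal nodes), and for $A\subseteq\hat B$ put $A\restriction k=\{a\in A:\max a<k\}$ (where $\emptyset$ counts as having $\max\emptyset<k$ for every $k$). A map $f:\mathcal W\to\mathcal V$ between ultrafilters is *cofinal* if the image of every filter base for $\mathcal W$ is a filter base for $\mathcal V$, and *monotone* if $X\supseteq Y$ implies $f(X)\supseteq f(Y)$. An ultrafilter $\mathcal W$ on $B$ for which the sets $[T]$, $T$ a $\vec{\mathcal U}$-tree, form a base *has basic Tukey reductions* if for every ultrafilter $\mathcal V$ on $\omega$ and every monotone cofinal $f:\mathcal W\to\mathcal V$ there are a $\vec{\mathcal U}$-tree $\tilde T$, a strictly increasing sequence $(n_k)_{k<\omega}$ for which the sets $\tilde T\restriction n_k$ are strictly increasing, and a map $\hat f:\bigcup_k 2^{\tilde T\restriction n_k}\to 2^{<\omega}$ such that (identifying sets with characteristic functions, and writing $\hat f_k(A)$ for the value of $\hat f$ at the characteristic function of $A\subseteq\tilde T\restriction n_k$ on the domain $\tilde T\restriction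 n_k$) 1. (level preserving) $\hat f_k(A)\subseteq k=\{0,\dots,k-1\}$ for $A\subseteq\tilde T\restriction n_k$; 2. (end-extension preserving) if $k<m$, $A\subseteq\tilde T\restriction n_k$, $A'\subseteq\tilde T\restriction n_m$ and $A=A'\restriction n_k$, then $\hat f_k(A)=\hat f_m(A')\cap k$; 3. (monotone) if $k\le m$, $A\subseteq\tilde T\restriction n_k$, $A'\subseteq\tilde T\restriction n_m$ and $A\subseteq A'$, then $\hat f_k(A)\subseteq\hat f_m(A')$; 4. (generates $f$) $f([T])=\bigcup_{k<\omega}\hat f_k(T\restriction n_k)$ for every $\vec{\mathcal U}$-tree $T\subseteq\tilde T$. The *Fubini product* $\lim_{n\to\mathcal U}\mathcal V_n$ of ultrafilters $\mathcal V_n$ on sets $S_n$ over an ultrafilter $\mathcal U$ on $\omega$ is the ultrafilter of all $A\subseteq\bigsqcup_n S_n=\{(n,j):n<\omega,\ j\in S_n\}$ with $\{n:\{j\in S_n:(n,j)\in A\}\in\mathcal V_n\}\in\mathcal U$. The *countable iterates of Fubini products of p-points* form the smallest class of ultrafilters that contains all p-points, contains $\lim_{n\to\mathcal U}\mathcal V_n$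 whenever $\mathcal U$ is a p-point and all $\mathcal V_n$ are in the class, and is closed under bijections of base sets. **Theorem 4.4.** Let $B$ be a flat-top front and let $(\mathcal U_c:c\in\hat B^-)$ be a sequence of p-points. Then the sets $[T]$, $T$ a $\vec{\mathcal U}$-tree, form a base of an ultrafilter on $B$, and this ultrafilter has basic Tukey reductions. Consequently every countable iterate of Fubini products of p-points has basic Tukey reductions: it is carried, by a bijection of base sets, to the ultrafilter generated by the $\vec{\mathcal U}$-trees on $B$ for some flat-top front $B$ and some p-points $(\mathcal U_c:c\in\hat B^-)$, and this ultrafilter has basic Tukey reductions. -/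

import Mathlib

namespace FubiniTukey

open Set

/-! ### p-points -/

/-- A p-point: a nonprincipal ultrafilter on `ω` in which every decreasing sequence of members
has a pseudo-intersection belonging to the ultrafilter. -/
def IsPPoint (U : Ultrafilter ℕ) : Prop :=
  (∀ n : ℕ, U ≠ pure n) ∧
    ∀ X : ℕ → Set ℕ, Antitone X → (∀ n, X n ∈ U) → ∃ Y ∈ U, ∀ n, (Y \ X n).Finite

/-! ### Initial segments, fronts, flat-top fronts -/

/-- `a ⊑ X`: the set `a` is an initial segment of `X` (in the increasing enumeration). -/
def InitSeg (a X : Set ℕ) : Prop :=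
  a ⊆ X ∧ ∀ x ∈ X, x ∉ a → ∀ y ∈ a, y < x

/-- `a ⊏ X`: the set `a` is a proper initial segment of `X`. -/
def ProperInitSeg (a X : Set ℕ) : Prop :=
  InitSeg a X ∧ a ≠ X

/-- `B` is a front on the infinite set `I ⊆ ω`. -/
def IsFront (I : Set ℕ) (B : Set (Finset ℕ)) : Prop :=
  I.Infinite ∧ (∀ b ∈ B, (b : Set ℕ) ⊆ I) ∧
    (∀ a ∈ B, ∀ b ∈ B, ¬ ProperInitSeg (a : Set ℕ) b) ∧
    ∀ X : Set ℕ, X ⊆ I → X.Infinite → ∃ b ∈ B, ProperInitSeg (b : Set ℕ) X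

/-- `B` is a flat-top front. In the second alternative, `a = b \ {max b}` for the member
`b = a ∪ {m}` of `B`, where `m` exceeds all elements of `a`. -/
def IsFlatTopFront (B : Set (Finset ℕ)) : Prop :=
  IsFront univ B ∧ B ≠ {∅} ∧
    (B = {b | b.card = 1} ∨
      ((∀ b ∈ B, 2 ≤ b.card) ∧
        ∀ (a : Finset ℕ) (m : ℕ), (∀ x ∈ a, x < m) → insert m a ∈ B →
          {d : Finset ℕ | ∃ c ∈ B, ProperInitSeg (a : Set ℕ) c ∧ d = c \ a} =
            {d : Finset ℕ | ∃ l : ℕ, (∀ x ∈ a, x < l) ∧ d = {l}}))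

/-- `B̂`: all initial segments of members of `B`. -/
def hat (B : Set (Finset ℕ)) : Set (Finset ℕ) :=
  {a | ∃ b ∈ B, InitSeg (a : Set ℕ) b}

/-- `B̂⁻`: all proper initial segments of members of `B`. -/
def hatMinus (B : Set (Finset ℕ)) : Set (Finset ℕ) :=
  {a | ∃ b ∈ B, ProperInitSeg (a : Set ℕ) b}

/-! ### Trees of ultrafilters -/

/-- A set of finite sets is a tree when it is closed under initial segments. -/
def IsTree (T : Set (Finset ℕ)) : Prop :=
  ∀ t ∈ T, ∀ s : Finset ℕ, InitSeg (s : Set ℕ) t → s ∈ T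

/-- `T` is a `(U c : c ∈ B̂⁻)`-tree. Only the values of `U` on `B̂⁻` are used. -/
def IsUTree (B : Set (Finset ℕ)) (U : Finset ℕ → Ultrafilter ℕ) (T : Set (Finset ℕ)) : Prop :=
  T ⊆ hat B ∧ IsTree T ∧ ∅ ∈ T ∧
    ∀ c ∈ T ∩ hatMinus B, {n : ℕ | insert n c ∈ T} ∈ U c

/-- `[T]`, as a subset of the base set `B`: the maximal branches of `T`, each identified with
the maximal node at which it ends. -/
def branches (B : Set (Finset ℕ)) (T : Set (Finset ℕ)) : Set B :=
  {b | (b : Finset ℕ) ∈ T ∧ ∀ t ∈ T, ¬ ProperInitSeg ((b : Finset ℕ) : Set ℕ) t}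

/-- `W` is the ultrafilter on the base set `B` generated by the `U`-trees: the sets `[T]`, with
`T` a `U`-tree, form a base of `W`. -/
def IsGeneratedByTrees (B : Set (Finset ℕ)) (U : Finset ℕ → Ultrafilter ℕ)
    (W : Ultrafilter B) : Prop :=
  (W : Filter B).HasBasis (IsUTree B U) (branches B)

/-! ### Monotone cofinal maps

A map from an ultrafilter `W` to an ultrafilter `V` is given by a function on all subsets, of
which only the values on members of `W` matter. -/

/-- `C` is a filter base for the ultrafilter `W`. -/
def IsBaseFor {α : Type} (W : Ultrafilter α) (C : Set (Set α)) : Prop :=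
  (∀ X ∈ C, X ∈ W) ∧ ∀ Y ∈ W, ∃ X ∈ C, X ⊆ Y

/-- `f` is a cofinal map from `W` to `V`: it maps every filter base for `W` to a filter base
for `V` (and so, in particular, members of `W` to members of `V`). -/
def IsCofinalMap {α β : Type} (W : Ultrafilter α) (V : Ultrafilter β)
    (f : Set α → Set β) : Prop :=
  ∀ C : Set (Set α), IsBaseFor W C → IsBaseFor V (f '' C)

/-- `f` is monotone on `W`. -/
def IsMonotoneMap {α β : Type} (W : Ultrafilter α) (f : Set α → Set β) : Prop :=
  ∀ X ∈ W, ∀ Y ∈ W, Y ⊆ X → f Y ⊆ f X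

/-! ### Basic maps -/

/-- `A ↾ k = {a ∈ A : max a < k}` (the empty set belongs to `A ↾ k` as soon as it is in `A`). -/
def cut (A : Set (Finset ℕ)) (k : ℕ) : Set (Finset ℕ) :=
  {a ∈ A | ∀ x ∈ a, x < k}

/-- `g : ⋃ₖ 2^(T ↾ nₖ) → 2^{<ω}` is basic: level preserving, end-extension preserving and
monotone. Characteristic functions are written as sets together with the level that gives
their domain: `g k A` is the value of `g` at the characteristic function of `A ⊆ T ↾ nₖ` on
the domain of level `k`, and it is an element of `2^k`, that is, a subset of
`k = {0, …, k - 1}`. The domains `T ↾ nₖ` are required to be strictly increasing, so the level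
is determined by the domain. Only values `g k A` with `A ⊆ T ↾ nₖ` matter. -/
structure IsBasic (T : Set (Finset ℕ)) (n : ℕ → ℕ)
    (g : ℕ → Set (Finset ℕ) → Finset ℕ) : Prop where
  strictMono : StrictMono n
  strictMono_cut : StrictMono fun k => cut T (n k)
  level : ∀ k, ∀ A ⊆ cut T (n k), g k A ⊆ Finset.range k
  endExt : ∀ k m, k < m → ∀ A ⊆ cut T (n k), ∀ A' ⊆ cut T (n m), A = cut A' (n k) →
    g k A = g m A' ∩ Finset.range k
  mono : ∀ k m, k ≤ m → ∀ A ⊆ cut T (n k), ∀ A' ⊆ cut T (n m), A ⊆ A' → g k A ⊆ g m A'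

/-- `g` generates `f` on the `U`-trees contained in `T`. -/
def Generates (B : Set (Finset ℕ)) (U : Finset ℕ → Ultrafilter ℕ) (T : Set (Finset ℕ))
    (n : ℕ → ℕ) (g : ℕ → Set (Finset ℕ) → Finset ℕ) (f : Set B → Set ℕ) : Prop :=
  ∀ S, IsUTree B U S → S ⊆ T → f (branches B S) = ⋃ k, (g k (cut S (n k)) : Set ℕ)

/-- The ultrafilter `W` on `B`, generated by the `U`-trees, has basic Tukey reductions. -/
def HasBasicTukeyReductions (B : Set (Finset ℕ)) (U : Finset ℕ → Ultrafilter ℕ)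
    (W : Ultrafilter B) : Prop :=
  ∀ (V : Ultrafilter ℕ) (f : Set B → Set ℕ), IsMonotoneMap W f → IsCofinalMap W V f →
    ∃ (T : Set (Finset ℕ)) (n : ℕ → ℕ) (g : ℕ → Set (Finset ℕ) → Finset ℕ),
      IsUTree B U T ∧ IsBasic T n g ∧ Generates B U T n g f

/-! ### Countable iterates of Fubini products -/

/-- The Fubini product `lim_{n → U} V n`, on the disjoint union of the base sets of the `V n`
(for `V n` on `ω` this is `ω × ω`). -/
def fubiniLim (U : Ultrafilter ℕ) {α : ℕ → Type} (V : ∀ n, Ultrafilter (α n)) :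
    Ultrafilter (Σ n, α n) :=
  U.bind fun n => (V n).map (Sigma.mk n)

theorem mem_fubiniLim (U : Ultrafilter ℕ) {α : ℕ → Type} (V : ∀ n, Ultrafilter (α n))
    (A : Set (Σ n, α n)) :
    A ∈ fubiniLim U V ↔ {n : ℕ | {j : α n | (⟨n, j⟩ : Σ n, α n) ∈ A} ∈ V n} ∈ U :=
  Iff.rfl

/-- Countable iterates of Fubini products of p-points: the smallest class of ultrafilters which
contains the p-points and, with `V 0, V 1, …`, all `lim_{n → U} V n` with `U` a p-point, and
which is closed under bijections of base sets. -/
inductive IsFubiniIterate : (α : Type) → Ultrafilter α → Prop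
  | pPoint (U : Ultrafilter ℕ) : IsPPoint U → IsFubiniIterate ℕ U
  | lim (U : Ultrafilter ℕ) (α : ℕ → Type) (V : ∀ n, Ultrafilter (α n)) :
      IsPPoint U → (∀ n, IsFubiniIterate (α n) (V n)) →
        IsFubiniIterate (Σ n, α n) (fubiniLim U V)
  | equiv (α β : Type) (e : α ≃ β) (W : Ultrafilter α) :
      IsFubiniIterate α W → IsFubiniIterate β (W.map e)

end FubiniTukey

namespace FubiniTukey

open Set

/-! ### Initial segments -/

/-! Trees of ultrafilters generate an ultrafilter because a front is well founded under
end-extension. By bar induction, above each node of `hat B` one can build a tree with all branches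
in a given `A`, or one with all branches outside it: at an inner node the ultrafilter there decides
which alternative holds for almost all successors (`secures_or_secures_compl`).

For basic reductions, fix for each level `n`, each `i < n` and each finite trace `s` a tree `R` with
trace `s` below `n` and `i` outside `f` of its branches, if there is one. Each level has finitely
many such trees, so p-points allow a diagonalization (`exists_isUTree_diagonal`): there are one tree
`T` and infinitely many levels `n` such that a successor step of `T` by some `l ≥ n` never leaves a
tree `R` of level `n`. Suppose `S' ⊆ T` has its trace at such a level inside that of `S`, and `i` is
not in the image of `S`. Then `S'` lies inside the corresponding `R`, and by monotonicity `i` is not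
in the image of `S'` either. Hence `T ↾ n` decides membership of each `i < n`, and the finite map
can be read off (`hasBasicTukeyReductions`).

Iterated Fubini products are reached by induction. Placing shifted copies of flat-top fronts above
the points `{n}` gives a flat-top front, and its tree ultrafilter is the Fubini limit
(`map_fubiniLim_eq`). -/

theorem InitSeg.refl (a : Set ℕ) : InitSeg a a :=
  ⟨Subset.rfl, fun _ hx hx' => absurd hx hx'⟩

theorem InitSeg.trans {a b c : Set ℕ} (hab : InitSeg a b) (hbc : InitSeg b c) : InitSeg a c := by
  refine ⟨hab.1.trans hbc.1, fun x hx hxa y hy => ?_⟩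
  by_cases hxb : x ∈ b
  · exact hab.2 x hxb hxa y hy
  · exact hbc.2 x hx hxb y (hab.1 hy)

theorem InitSeg.of_subset {a b c : Set ℕ} (hac : InitSeg a c) (hab : a ⊆ b) (hbc : b ⊆ c) :
    InitSeg a b :=
  ⟨hab, fun x hx => hac.2 x (hbc hx)⟩

theorem InitSeg.total {a b c : Set ℕ} (hac : InitSeg a c) (hbc : InitSeg b c) :
    InitSeg a b ∨ InitSeg b a := by
  by_cases h : a ⊆ b
  · exact Or.inl (hac.of_subset h hbc.1)
  · obtain ⟨x, hxa, hxb⟩ := not_subset.1 h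
    refine Or.inr (hbc.of_subset (fun y hy => ?_) hac.1)
    by_contra hya
    exact lt_asymm (hbc.2 x (hac.1 hxa) hxb y hy) (hac.2 y (hbc.1 hy) hya x hxa)

theorem InitSeg.trans_proper {a b c : Set ℕ} (hab : InitSeg a b) (hbc : ProperInitSeg b c) :
    ProperInitSeg a c :=
  ⟨hab.trans hbc.1, fun h => hbc.2 (hbc.1.1.antisymm (h ▸ hab.1))⟩

theorem initSeg_empty (a : Set ℕ) : InitSeg ((∅ : Finset ℕ) : Set ℕ) a := by
  simp [InitSeg]

theorem initSeg_insert {u : Finset ℕ} {l : ℕ} (hl : ∀ x ∈ u, x < l) :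
    InitSeg (u : Set ℕ) (insert l u : Finset ℕ) := by
  refine ⟨by simp, fun x hx hxu y hy => ?_⟩
  have : x = l := by simpa [show x ∉ u from hxu] using hx
  exact this ▸ hl y hy

theorem properInitSeg_insert {u : Finset ℕ} {l : ℕ} (hl : ∀ x ∈ u, x < l) :
    ProperInitSeg (u : Set ℕ) (insert l u : Finset ℕ) := by
  refine ⟨initSeg_insert hl, fun h => ?_⟩
  have : l ∈ (u : Set ℕ) := h ▸ Finset.mem_coe.2 (Finset.mem_insert_self l u)
  exact lt_irrefl _ (hl l this)

theorem InitSeg.eq_or_of_insert {a u : Finset ℕ} {l : ℕ} (hl : ∀ x ∈ u, x < l)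
    (h : InitSeg (a : Set ℕ) (insert l u : Finset ℕ)) :
    a = insert l u ∨ InitSeg (a : Set ℕ) u := by
  by_cases hla : l ∈ a
  · left
    refine Finset.Subset.antisymm (by exact_mod_cast h.1) (fun x hx => ?_)
    by_contra hxa
    have hlx := h.2 x (by exact_mod_cast hx) (by exact_mod_cast hxa) l (by exact_mod_cast hla)
    rcases Finset.mem_insert.1 hx with rfl | hxu
    · exact lt_irrefl _ hlx
    · exact lt_asymm hlx (hl x hxu)
  · right
    refine h.of_subset (fun x hx => ?_) (by simp)
    have hx' := h.1 hx
    rcases Finset.mem_insert.1 (Finset.mem_coe.1 hx') with rfl | hxu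
    · exact absurd hx hla
    · exact hxu

/-! ### Fronts -/

section Front

variable {B : Set (Finset ℕ)}

theorem hatMinus_subset_hat : hatMinus B ⊆ hat B :=
  fun _ ⟨b, hb, h⟩ => ⟨b, hb, h.1⟩

theorem subset_hat : B ⊆ hat B :=
  fun b hb => ⟨b, hb, InitSeg.refl _⟩

theorem mem_or_mem_hatMinus {c : Finset ℕ} (hc : c ∈ hat B) : c ∈ B ∨ c ∈ hatMinus B := by
  obtain ⟨b, hb, h⟩ := hc
  by_cases hcb : c = b
  · exact Or.inl (hcb ▸ hb)
  · exact Or.inr ⟨b, hb, h, fun h' => hcb (Finset.coe_injective h')⟩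

theorem isTree_hat : IsTree (hat B) :=
  fun _ ⟨b, hb, h⟩ _ hs => ⟨b, hb, hs.trans h⟩

theorem IsFront.not_initSeg_hatMinus {I : Set ℕ} (hB : IsFront I B) {b c : Finset ℕ} (hb : b ∈ B)
    (hc : c ∈ hatMinus B) : ¬ InitSeg (b : Set ℕ) c := by
  obtain ⟨b', hb', h⟩ := hc
  exact fun hbc => hB.2.2.1 b hb b' hb' (hbc.trans_proper h)

/-- Some member of the front lies on the infinite set `insert l c ∪ (l, ∞)`. It is comparable with
`insert l c`, and it cannot be an initial segment of `c`. -/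
theorem IsFront.insert_mem_hat (hB : IsFront univ B) {c : Finset ℕ} {l : ℕ}
    (hc : c ∈ hatMinus B) (hl : ∀ x ∈ c, x < l) : insert l c ∈ hat B := by
  have hX : InitSeg ((insert l c : Finset ℕ) : Set ℕ) ({x | x ∈ insert l c} ∪ Ioi l) := by
    refine ⟨fun x hx => Or.inl hx, fun x hx hxc y hy => ?_⟩
    have hlx : l < x := by
      rcases hx with hx | hx
      · exact absurd hx hxc
      · exact hx
    rcases Finset.mem_insert.1 (Finset.mem_coe.1 hy) with rfl | hy
    · exact hlx
    · exact (hl y hy).trans hlx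
  obtain ⟨b, hb, hbX⟩ := hB.2.2.2 ({x | x ∈ insert l c} ∪ Ioi l) (subset_univ _)
    ((Ioi_infinite l).mono subset_union_right)
  rcases hX.total hbX.1 with h | h
  · exact ⟨b, hb, h⟩
  · rcases h.eq_or_of_insert hl with rfl | h
    · exact subset_hat hb
    · exact absurd h (hB.not_initSeg_hatMinus hb hc)

/-- Bar induction along a front. -/
theorem IsFront.bar_induction (hB : IsFront univ B) {P : Finset ℕ → Prop} (hP : ∀ b ∈ B, P b)
    (hstep : ∀ c ∈ hatMinus B, (∀ l, (∀ x ∈ c, x < l) → P (insert l c)) → P c)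
    (c : Finset ℕ) (hc : c ∈ hat B) : P c := by
  by_contra hcP
  have key : ∀ u : {u : Finset ℕ // u ∈ hat B ∧ ¬ P u},
      ∃ v : {u : Finset ℕ // u ∈ hat B ∧ ¬ P u}, ∃ l, (∀ x ∈ u.1, x < l) ∧ v.1 = insert l u.1 := by
    rintro ⟨u, hu, huP⟩
    have huB : u ∈ hatMinus B :=
      (mem_or_mem_hatMinus hu).resolve_left fun h => huP (hP u h)
    have := mt (hstep u huB) huP
    push Not at this
    obtain ⟨l, hl, hlP⟩ := this
    exact ⟨⟨insert l u, hB.insert_mem_hat huB hl, hlP⟩, l, hl, rfl⟩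
  choose next l hl hnext using key
  -- A failure at `c` propagates to an infinite chain of failing nodes. The member of the front on
  -- the union of the chain would end-extend every node of the chain, yet it is finite.
  let s : ℕ → {u : Finset ℕ // u ∈ hat B ∧ ¬ P u} := fun k => next^[k] ⟨c, hc, hcP⟩
  have hs : ∀ k, (s (k + 1)).1 = insert (l (s k)) (s k).1 := fun k => by
    simp only [s, Function.iterate_succ_apply', hnext]
  have hseg : ∀ k m, k ≤ m → InitSeg ((s k).1 : Set ℕ) (s m).1 := by
    intro k m hkm
    induction m, hkm using Nat.le_induction with
    | base => exact InitSeg.refl _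
    | succ m _ ih =>
      rw [hs m]
      exact ih.trans (initSeg_insert (hl (s m)))
  have hmem : ∀ k, l (s k) ∈ (s (k + 1)).1 := fun k => by simp [hs k]
  have hmono : StrictMono fun k => l (s k) :=
    strictMono_nat_of_lt_succ fun k => hl (s (k + 1)) _ (hmem k)
  have hX : (⋃ k, ((s k).1 : Set ℕ)).Infinite := by
    refine (infinite_range_of_injective hmono.injective).mono ?_
    rintro _ ⟨k, rfl⟩
    exact mem_iUnion.2 ⟨k + 1, hmem k⟩
  obtain ⟨b, hb, hbX⟩ := hB.2.2.2 _ (subset_univ _) hX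
  have hsX : ∀ k, InitSeg ((s k).1 : Set ℕ) (⋃ k, ((s k).1 : Set ℕ)) := by
    refine fun k => ⟨subset_iUnion (fun k => ((s k).1 : Set ℕ)) k, fun x hx hxk => ?_⟩
    obtain ⟨m, hm⟩ := mem_iUnion.1 hx
    rcases le_total k m with h | h
    · exact (hseg k m h).2 x hm hxk
    · exact absurd ((hseg m k h).1 hm) hxk
  have hsB : ∀ k, (s k).1 ∈ hatMinus B := fun k =>
    (mem_or_mem_hatMinus (s k).2.1).resolve_left fun h => (s k).2.2 (hP _ h)
  have hbs : ∀ k, InitSeg ((s k).1 : Set ℕ) b := fun k =>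
    ((hsX k).total hbX.1).resolve_right (hB.not_initSeg_hatMinus hb (hsB k))
  exact hX (b.finite_toSet.subset (iUnion_subset fun k => (hbs k).1))

end Front

/-! ### The ultrafilter generated by the trees -/

section Trees

variable {B : Set (Finset ℕ)} {U : Finset ℕ → Ultrafilter ℕ}

theorem IsPPoint.finite_notMem {V : Ultrafilter ℕ} (hV : IsPPoint V) {s : Set ℕ}
    (hs : s.Finite) : s ∉ V := by
  intro hsV
  obtain ⟨n, _, hn⟩ := Ultrafilter.eq_pure_of_finite_mem hs hsV
  exact hV.1 n hn

theorem IsPPoint.eventually_gt {V : Ultrafilter ℕ} (hV : IsPPoint V) (c : Finset ℕ) :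
    {l | ∀ x ∈ c, x < l} ∈ V := by
  by_contra h
  rw [← Ultrafilter.compl_mem_iff_notMem] at h
  refine hV.finite_notMem ((finite_Iic (c.sup id)).subset fun l hl => ?_) h
  simp only [mem_compl_iff, mem_ofPred_eq, not_forall, not_lt] at hl
  obtain ⟨x, hx, hlx⟩ := hl
  exact hlx.trans (Finset.le_sup (f := id) hx)

theorem IsUTree.inter {S T : Set (Finset ℕ)} (hS : IsUTree B U S) (hT : IsUTree B U T) :
    IsUTree B U (S ∩ T) :=
  ⟨fun _ h => hS.1 h.1, fun t ht s hs => ⟨hS.2.1 t ht.1 s hs, hT.2.1 t ht.2 s hs⟩,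
    ⟨hS.2.2.1, hT.2.2.1⟩, fun c hc => Filter.inter_mem (hS.2.2.2 c ⟨hc.1.1, hc.2⟩)
      (hT.2.2.2 c ⟨hc.1.2, hc.2⟩)⟩

theorem IsFront.mem_branches (hB : IsFront univ B) {T : Set (Finset ℕ)} (hT : T ⊆ hat B) (b : B) :
    b ∈ branches B T ↔ (b : Finset ℕ) ∈ T := by
  refine ⟨fun h => h.1, fun h => ⟨h, fun t ht hbt => ?_⟩⟩
  obtain ⟨b', hb', h'⟩ := hT ht
  exact hB.2.2.1 b b.2 b' hb' ⟨hbt.1.trans h', fun e => hbt.2 (hbt.1.1.antisymm (e ▸ h'.1))⟩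

/-- The nodes of `B̂` whose successors at all stages stay in `X`. -/
def treeOf (B : Set (Finset ℕ)) (X : Finset ℕ → Set ℕ) : Set (Finset ℕ) :=
  {t ∈ hat B | ∀ (u : Finset ℕ) (l : ℕ), (∀ x ∈ u, x < l) →
    InitSeg ((insert l u : Finset ℕ) : Set ℕ) t → l ∈ X u}

theorem isUTree_treeOf (hB : IsFront univ B) (hU : ∀ c ∈ hatMinus B, IsPPoint (U c))
    (h0 : ∅ ∈ hat B) {X : Finset ℕ → Set ℕ} (hX : ∀ c ∈ hatMinus B, X c ∈ U c) :
    IsUTree B U (treeOf B X) := by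
  refine ⟨fun t ht => ht.1, fun t ht s hs => ⟨isTree_hat t ht.1 s hs, fun u l hl h =>
    ht.2 u l hl (h.trans hs)⟩, ⟨h0, fun u l _ h => ?_⟩, fun c hc => ?_⟩
  · simpa using h.1 (Finset.mem_coe.2 (Finset.mem_insert_self l u))
  · filter_upwards [(hU c hc.2).eventually_gt c, hX c hc.2] with l hl hlX
    refine ⟨hB.insert_mem_hat hc.2 hl, fun u m hm h => ?_⟩
    rcases h.eq_or_of_insert hl with h | h
    -- Both `m` and `l` are maxima of the same set, so the two decompositions coincide.
    · have hml : m = l := by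
        have h1 : m ∈ insert l c := h ▸ Finset.mem_insert_self m u
        have h2 : l ∈ insert m u := h ▸ Finset.mem_insert_self l c
        rcases Finset.mem_insert.1 h1 with h1 | h1
        · exact h1
        · rcases Finset.mem_insert.1 h2 with h2 | h2
          · exact h2.symm
          · exact absurd (hl m h1) (lt_asymm (hm l h2))
      subst hml
      have huc : u = c := by
        have h1 : m ∉ u := fun h => lt_irrefl _ (hm m h)
        have h2 : m ∉ c := fun h => lt_irrefl _ (hl m h)
        rw [← Finset.erase_insert h1, h, Finset.erase_insert h2]
      rwa [huc]
    · exact hc.1.2 u m hm h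

/-- The nodes above which a tree of ultrafilters with all branches in `A` can be built. -/
inductive Secures (B : Set (Finset ℕ)) (U : Finset ℕ → Ultrafilter ℕ) (A : Set (Finset ℕ)) :
    Finset ℕ → Prop
  | leaf (b : Finset ℕ) : b ∈ B → b ∈ A → Secures B U A b
  | node (c : Finset ℕ) (E : Set ℕ) : c ∈ hatMinus B → E ∈ U c →
      (∀ l ∈ E, Secures B U A (insert l c)) → Secures B U A c

theorem secures_or_secures_compl (hB : IsFront univ B)
    (hU : ∀ c ∈ hatMinus B, IsPPoint (U c)) (A : Set (Finset ℕ)) (c : Finset ℕ) (hc : c ∈ hat B) :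
    Secures B U A c ∨ Secures B U Aᶜ c := by
  refine hB.bar_induction (P := fun c => Secures B U A c ∨ Secures B U Aᶜ c) (fun b hb => ?_)
    (fun c hc ih => ?_) c hc
  · by_cases h : b ∈ A
    · exact Or.inl (.leaf b hb h)
    · exact Or.inr (.leaf b hb h)
  · by_cases h : {l | Secures B U A (insert l c)} ∈ U c
    · exact Or.inl (.node c _ hc h fun l hl => hl)
    · rw [← Ultrafilter.compl_mem_iff_notMem] at h
      exact Or.inr (.node c _ hc (Filter.inter_mem h ((hU c hc).eventually_gt c))
        fun l hl => (ih l hl.2).resolve_left hl.1)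

/-- The witness consists of the nodes all of whose initial segments are secured; the set `E` at an
inner node supplies enough successors. -/
theorem Secures.exists_isUTree (hB : IsFront univ B) (hU : ∀ c ∈ hatMinus B, IsPPoint (U c))
    (h0 : ∅ ∈ hat B) {A : Set (Finset ℕ)} (hA : Secures B U A ∅) :
    ∃ T, IsUTree B U T ∧ ∀ b ∈ T, b ∈ B → b ∈ A := by
  refine ⟨{t ∈ hat B | ∀ s : Finset ℕ, InitSeg (s : Set ℕ) t → Secures B U A s},
    ⟨fun t ht => ht.1, fun t ht s hs => ⟨isTree_hat t ht.1 s hs, fun r hr =>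
      ht.2 r (hr.trans hs)⟩, ⟨h0, fun s hs => ?_⟩, fun c hc => ?_⟩, fun b hbT hb => ?_⟩
  · have : s = ∅ := by simpa using hs.1
    exact this ▸ hA
  · rcases hc.1.2 c (InitSeg.refl _) with ⟨_, hcB, _⟩ | ⟨_, E, _, hE, hs⟩
    · exact absurd (InitSeg.refl _) (hB.not_initSeg_hatMinus hcB hc.2)
    · filter_upwards [hE, (hU c hc.2).eventually_gt c] with l hlE hl
      refine ⟨hB.insert_mem_hat hc.2 hl, fun s hsl => ?_⟩
      rcases hsl.eq_or_of_insert hl with rfl | h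
      · exact hs l hlE
      · exact hc.1.2 s h
  · rcases hbT.2 b (InitSeg.refl _) with ⟨_, _, hbA⟩ | ⟨_, _, hb', _, _⟩
    · exact hbA
    · exact absurd (InitSeg.refl _) (hB.not_initSeg_hatMinus hb hb')

theorem IsUTree.exists_mem (hB : IsFront univ B) (hU : ∀ c ∈ hatMinus B, IsPPoint (U c))
    {T : Set (Finset ℕ)} (hT : IsUTree B U T) : ∃ b ∈ B, b ∈ T := by
  have h := hB.bar_induction (P := fun c => c ∈ T → ∃ b ∈ B, b ∈ T) (fun b hb hbT => ⟨b, hb, hbT⟩)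
    (fun c hc ih hcT => ?_) ∅ (hT.1 hT.2.2.1)
  · exact h hT.2.2.1
  · obtain ⟨l, hl, hlT⟩ := Ultrafilter.nonempty_of_mem
      (Filter.inter_mem ((hU c hc).eventually_gt c) (hT.2.2.2 c ⟨hcT, hc⟩))
    exact ih l hl hlT

theorem exists_isGeneratedByTrees (hB : IsFront univ B)
    (hU : ∀ c ∈ hatMinus B, IsPPoint (U c)) (h0 : ∅ ∈ hat B) :
    ∃ W : Ultrafilter B, IsGeneratedByTrees B U W := by
  have hbasis : Filter.IsBasis (IsUTree B U) (branches B) := by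
    refine ⟨⟨treeOf B fun _ => univ, isUTree_treeOf hB hU h0 fun _ _ => Filter.univ_mem⟩,
      fun {S T} hS hT => ⟨S ∩ T, hS.inter hT, fun b hb => ?_⟩⟩
    rw [hB.mem_branches (hS.inter hT).1] at hb
    exact ⟨(hB.mem_branches hS.1 b).2 hb.1, (hB.mem_branches hT.1 b).2 hb.2⟩
  refine ⟨Ultrafilter.ofComplNotMemIff hbasis.filter fun A => ?_, hbasis.hasBasis⟩
  simp only [hbasis.mem_filter_iff]
  constructor
  · intro hA
    have h := secures_or_secures_compl hB hU (Subtype.val '' A) ∅ h0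
    rcases h with h | h
    · obtain ⟨T, hT, hTA⟩ := h.exists_isUTree hB hU h0
      refine ⟨T, hT, fun b hb => ?_⟩
      obtain ⟨a, ha, hab⟩ := hTA b ((hB.mem_branches hT.1 b).1 hb) b.2
      exact Subtype.ext hab ▸ ha
    · obtain ⟨T, hT, hTA⟩ := h.exists_isUTree hB hU h0
      exact absurd ⟨T, hT, fun b hb hbA =>
        hTA b ((hB.mem_branches hT.1 b).1 hb) b.2 ⟨b, hbA, rfl⟩⟩ hA
  -- The two trees meet in a tree, which still contains a member of `B`; it would lie both in `A`
  -- and in its complement.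
  · rintro ⟨S, hS, hSA⟩ ⟨T, hT, hTA⟩
    obtain ⟨b, hb, hbST⟩ := (hS.inter hT).exists_mem hB hU
    exact hTA ((hB.mem_branches hT.1 ⟨b, hb⟩).2 hbST.2)
      (hSA ((hB.mem_branches hS.1 ⟨b, hb⟩).2 hbST.1))

end Trees

/-! ### Basic reductions -/

/-- Countably many p-points omit a common union of infinitely many prescribed intervals. -/
theorem exists_infinite_biUnion_Ico_notMem {ι : Type*} [Countable ι] {V : ι → Ultrafilter ℕ}
    (hV : ∀ i, IsPPoint (V i)) (H : ℕ → ℕ) :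
    ∃ N : Set ℕ, N.Infinite ∧ ∀ i, (⋃ n ∈ N, Ico n (H n)) ∉ V i := by
  classical
  -- The points `g j` are spaced so that the intervals `[g j, H (g j))` are pairwise disjoint.
  let g : ℕ → ℕ := fun j => Nat.rec 0 (fun _ m => max (H m) (m + 1)) j
  have hgs : ∀ j, g (j + 1) = max (H (g j)) (g j + 1) := fun j => rfl
  have hg : StrictMono g := strictMono_nat_of_lt_succ fun j => by rw [hgs]; omega
  have hdisj : ∀ j j' l, l ∈ Ico (g j) (H (g j)) → l ∈ Ico (g j') (H (g j')) → j ≤ j' := by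
    intro j j' l hl hl'
    by_contra! hlt
    have h1 := hg.monotone (Nat.succ_le_of_lt hlt)
    have h2 := hgs j'
    simp only [mem_Ico, Nat.succ_eq_add_one] at *
    omega
  -- Coding the finite restrictions of `x ⊆ ω` gives continuum many infinite index sets `N x`, any
  -- two of which are almost disjoint.
  let code : Set ℕ → ℕ → ℕ := fun x k => Encodable.encode (k, {i ∈ Finset.range k | i ∈ x})
  have hcode : ∀ x k y k', code x k = code y k' → k = k' ∧ ∀ i < k, i ∈ x ↔ i ∈ y := by
    intro x k y k' h
    obtain ⟨rfl, h⟩ := Prod.mk.inj (Encodable.encode_injective h)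
    refine ⟨rfl, fun i hi => ?_⟩
    simpa [hi] using Finset.ext_iff.1 h i
  let N : Set ℕ → Set ℕ := fun x => range fun k => g (code x k)
  have hN : ∀ x, (N x).Infinite := fun x =>
    infinite_range_of_injective (hg.injective.comp fun k k' h => (hcode x k x k' h).1)
  by_contra! hcon
  choose i hi using fun x => hcon (N x) (hN x)
  obtain ⟨e, he⟩ := exists_injective_nat ι
  -- If every `N x` failed, some index `i x` would have its ultrafilter contain the union for `x`.
  -- Two unions for distinct sets have finite intersection, so `i` would inject the power set of `ω`
  -- into a countable set.
  refine Function.cantor_injective (e ∘ i) (he.comp fun x y hxy => ?_)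
  by_contra hne
  obtain ⟨m, hm⟩ : ∃ m, ¬ (m ∈ x ↔ m ∈ y) := by
    by_contra! h
    exact hne (Set.ext h)
  refine (hV (i x)).finite_notMem ?_ (Filter.inter_mem (hi x) (hxy ▸ hi y))
  refine ((finite_Iic m).biUnion (t := fun k => Ico (g (code x k)) (H (g (code x k))))
    fun _ _ => finite_Ico _ _).subset ?_
  rintro l ⟨hlx, hly⟩
  simp only [N, mem_iUnion, mem_range, exists_prop, exists_exists_eq_and] at hlx hly
  obtain ⟨k, hk⟩ := hlx
  obtain ⟨k', hk'⟩ := hly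
  have hkk := hcode x k y k' ((hdisj _ _ l hk hk').antisymm (hdisj _ _ l hk' hk))
  refine mem_biUnion (x := k) ?_ hk
  by_contra hkm
  exact hm (hkk.2 m (by simpa using hkm))

section Reductions

variable {B : Set (Finset ℕ)} {U : Finset ℕ → Ultrafilter ℕ}

/-- Diagonalization: one tree and infinitely many levels `n` beyond which the tree follows all
members of the finite family `F n`. -/
theorem exists_isUTree_diagonal (hB : IsFront univ B) (hU : ∀ c ∈ hatMinus B, IsPPoint (U c))
    (h0 : ∅ ∈ hat B) {F : ℕ → Set (Set (Finset ℕ))} (hF : ∀ n, (F n).Finite)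
    (hFU : ∀ n, ∀ R ∈ F n, IsUTree B U R) :
    ∃ (T : Set (Finset ℕ)) (N : Set ℕ), IsUTree B U T ∧ N.Infinite ∧
      ∀ n ∈ N, ∀ R ∈ F n, ∀ (u : Finset ℕ) (l : ℕ), (∀ x ∈ u, x < l) → insert l u ∈ T → n ≤ l →
        u ∈ R → insert l u ∈ R := by
  let Z : Finset ℕ → ℕ → Set ℕ := fun u n => {l | ∀ m ∈ Iic n, ∀ R ∈ F m, u ∈ R → insert l u ∈ R}
  have hZ : ∀ u ∈ hatMinus B, ∀ n, Z u n ∈ U u := by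
    intro u hu n
    refine (Filter.eventually_all_finite (finite_Iic n)).2 fun m _ =>
      (Filter.eventually_all_finite (hF m)).2 fun R hR => ?_
    by_cases huR : u ∈ R
    · filter_upwards [(hFU m R hR).2.2.2 u ⟨huR, hu⟩] with l hl _ using hl
    · exact Filter.Eventually.of_forall fun l h => absurd h huR
  -- The p-point property at `u`: a single large `Y` lies in each `Z u n` from the bound `h n` on.
  have key : ∀ u : Finset ℕ, ∃ (Y : Set ℕ) (h : ℕ → ℕ), u ∈ hatMinus B →
      Y ∈ U u ∧ ∀ n, ∀ l ∈ Y, h n ≤ l → l ∈ Z u n := by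
    intro u
    by_cases hu : u ∈ hatMinus B
    · obtain ⟨Y, hY, hfin⟩ := (hU u hu).2 (Z u)
        (fun m n hmn l hl k hk => hl k (le_trans hk hmn)) (hZ u hu)
      choose b hb using fun n => (hfin n).bddAbove
      refine ⟨Y, fun n => b n + 1, fun _ => ⟨hY, fun n l hl hle => ?_⟩⟩
      by_contra hlZ
      exact absurd (hb n ⟨hl, hlZ⟩) (not_le.2 hle)
    · exact ⟨∅, id, fun h => absurd h hu⟩
  choose Y h hYh using key
  -- `H n` bounds `h u n` simultaneously for all nodes `u ⊆ n`, of which there are finitely many.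
  let H : ℕ → ℕ := fun n => (Finset.range n).powerset.sup fun u => h u n
  obtain ⟨N, hN, hNU⟩ := exists_infinite_biUnion_Ico_notMem
    (V := fun c : hatMinus B => U c) (fun c => hU c c.2) H
  -- For levels `n ≤ max u`, the factor `Z u (max u)` suffices. For `n > max u`, a successor `l ≥ n`
  -- avoids `[n, H n)`, so it is past `h u n`, where `Y u` lies inside `Z u n`.
  let X : Finset ℕ → Set ℕ := fun u => (Y u ∩ Z u (u.sup id)) ∩ (⋃ n ∈ N, Ico n (H n))ᶜ
  refine ⟨treeOf B X, N, isUTree_treeOf hB hU h0 fun c hc => Filter.inter_mem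
    (Filter.inter_mem (hYh c hc).1 (hZ c hc _)) (Ultrafilter.compl_mem_iff_notMem.2 (hNU ⟨c, hc⟩)),
    hN, fun n hn R hR u l hl hlT hnl huR => ?_⟩
  obtain ⟨⟨hlY, hlZ⟩, hlN⟩ := hlT.2 u l hl (InitSeg.refl _)
  have hu : u ∈ hatMinus B := by
    obtain ⟨b, hb, hlb⟩ := hlT.1
    refine ⟨b, hb, (initSeg_insert hl).trans hlb, fun hub => ?_⟩
    have hlu : l ∈ (u : Set ℕ) := hub ▸ hlb.1 (by simp)
    exact lt_irrefl _ (hl l hlu)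
  rcases le_or_gt n (u.sup id) with hle | hlt
  · exact hlZ n hle R hR huR
  · have hun : u ∈ (Finset.range n).powerset := Finset.mem_powerset.2 fun x hx =>
      Finset.mem_range.2 ((Finset.le_sup (f := id) hx).trans_lt hlt)
    have hle : h u n ≤ H n := Finset.le_sup (f := fun u => h u n) hun
    have hHl : H n ≤ l := by
      by_contra! hlt
      exact hlN (mem_biUnion hn ⟨hnl, hlt⟩)
    exact (hYh u hu).2 n l hlY (hle.trans hHl) n self_mem_Iic R hR huR

theorem finite_cut (A : Set (Finset ℕ)) (n : ℕ) : (cut A n).Finite :=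
  (Finset.range n).powerset.finite_toSet.subset fun _ ha =>
    Finset.mem_coe.2 (Finset.mem_powerset.2 fun x hx => Finset.mem_range.2 (ha.2 x hx))

theorem cut_mono {A A' : Set (Finset ℕ)} (h : A ⊆ A') {m n : ℕ} (hmn : m ≤ n) :
    cut A m ⊆ cut A' n :=
  fun _ ha => ⟨h ha.1, fun x hx => (ha.2 x hx).trans_le hmn⟩

theorem branches_mem {W : Ultrafilter B} (hW : IsGeneratedByTrees B U W) {T : Set (Finset ℕ)}
    (hT : IsUTree B U T) : branches B T ∈ W :=
  Filter.HasBasis.mem_of_mem hW hT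

/-- On a suitable tree, membership of `i` in a monotone image is decided by finite levels. -/
theorem exists_isUTree_decided (hB : IsFront univ B) (hU : ∀ c ∈ hatMinus B, IsPPoint (U c))
    (h0 : ∅ ∈ hat B) {W : Ultrafilter B} (hW : IsGeneratedByTrees B U W) {f : Set B → Set ℕ}
    (hf : IsMonotoneMap W f) :
    ∃ (T : Set (Finset ℕ)) (N : Set ℕ), IsUTree B U T ∧ N.Infinite ∧
      ∀ n ∈ N, ∀ i < n, ∀ S S' : Set (Finset ℕ), IsUTree B U S → IsUTree B U S' → S' ⊆ T →
        cut S' n ⊆ cut S n → i ∈ f (branches B S') → i ∈ f (branches B S) := by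
  -- `R n i s` is a counterexample with trace `s` when one exists, and otherwise an arbitrary tree.
  have key : ∀ (n i : ℕ) (s : Set (Finset ℕ)), ∃ R, IsUTree B U R ∧
      ((∃ S, IsUTree B U S ∧ cut S n = s ∧ i ∉ f (branches B S)) →
        cut R n = s ∧ i ∉ f (branches B R)) := by
    intro n i s
    by_cases h : ∃ S, IsUTree B U S ∧ cut S n = s ∧ i ∉ f (branches B S)
    · obtain ⟨S, hS, hSs⟩ := h
      exact ⟨S, hS, fun _ => hSs⟩
    · exact ⟨_, isUTree_treeOf hB hU h0 (X := fun _ => univ) fun _ _ => Filter.univ_mem,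
        fun h' => absurd h' h⟩
  choose R hR hRs using key
  obtain ⟨T, N, hT, hN, hTN⟩ := exists_isUTree_diagonal hB hU h0
    (F := fun n => image2 (R n) (Iio n) (𝒫 (cut (hat B) n)))
    (fun n => (finite_Iio n).image2 _ (finite_cut _ n).finite_subsets)
    (by rintro n _ ⟨i, _, s, _, rfl⟩; exact hR n i s)
  refine ⟨T, N, hT, hN, fun n hn i hi S S' hS hS' hS'T hcut hiS' => ?_⟩
  by_contra hiS
  obtain ⟨hRS, hiR⟩ := hRs n i (cut S n) ⟨S, hS, rfl, hiS⟩
  -- Nodes are built by adding maxima: below `n` the common trace puts them in `R`, from `n` on the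
  -- diagonal tree keeps them there.
  have hmem : ∀ t : Finset ℕ, t ∈ S' → t ∈ R n i (cut S n) := by
    intro t
    induction t using Finset.induction_on_max with
    | empty => exact fun _ => (hR n i _).2.2.1
    | insert l u hl ih =>
      intro ht
      rcases le_or_gt n l with hnl | hln
      · exact hTN n hn _ ⟨i, hi, _, cut_mono hS.1 le_rfl, rfl⟩ u l hl (hS'T ht) hnl
          (ih (hS'.2.1 _ ht u (initSeg_insert hl)))
      · have : insert l u ∈ cut S n := hcut ⟨ht, fun x hx => by
          rcases Finset.mem_insert.1 hx with rfl | hx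
          · exact hln
          · exact (hl x hx).trans hln⟩
        exact (hRS.ge this).1
  refine hiR (hf _ (branches_mem hW (hR n i _)) _ (branches_mem hW hS') (fun b hb => ?_) hiS')
  exact (hB.mem_branches (hR n i _).1 b).2 (hmem _ hb.1)

theorem hasBasicTukeyReductions (hB : IsFront univ B) (hU : ∀ c ∈ hatMinus B, IsPPoint (U c))
    (h0 : ∅ ∈ hatMinus B) {W : Ultrafilter B} (hW : IsGeneratedByTrees B U W) :
    HasBasicTukeyReductions B U W := by
  classical
  intro V f hf _
  obtain ⟨T, N, hT, hN, hTN⟩ := exists_isUTree_decided hB hU (hatMinus_subset_hat h0) hW hf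
  -- A node `{l}` with `m ≤ l < n` makes the cut at `n` strictly larger than the cut at `m`.
  have key : ∀ m, ∃ n, n ∈ N ∧ ∃ l, m ≤ l ∧ l < n ∧ {l} ∈ T := by
    intro m
    have hinf : {l | insert l ∅ ∈ T}.Infinite := fun hfin =>
      (hU ∅ h0).finite_notMem hfin (hT.2.2.2 ∅ ⟨hT.2.2.1, h0⟩)
    obtain ⟨l, hl, hml⟩ := hinf.exists_gt m
    obtain ⟨n, hn, hln⟩ := hN.exists_gt l
    exact ⟨n, hn, l, hml.le, hln, hl⟩
  choose next hnextN l hle hlt hlT using key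
  -- The exponent `k + 1` puts even `ν 0` in `N`.
  let ν : ℕ → ℕ := fun k => next^[k + 1] 0
  have hνs : ∀ k, ν (k + 1) = next (ν k) := fun k => Function.iterate_succ_apply' _ _ _
  have hνN : ∀ k, ν k ∈ N := fun k => by
    simp only [ν, Function.iterate_succ_apply']
    exact hnextN _
  have hν : StrictMono ν := strictMono_nat_of_lt_succ fun k => by
    rw [hνs]
    exact (hle _).trans_lt (hlt _)
  -- Membership of `i` is tested at the level `ν (i + 1)`, which exceeds `i` and does not depend on
  -- `k`. For `i < k` it is at most `ν k`, whence end-extension preservation.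
  refine ⟨T, ν, fun k A => {i ∈ Finset.range k | ∃ S, IsUTree B U S ∧ S ⊆ T ∧
    cut S (ν (i + 1)) ⊆ A ∧ i ∈ f (branches B S)}, hT, ⟨hν, ?_, ?_, ?_, ?_⟩, ?_⟩
  · refine strictMono_nat_of_lt_succ fun k => ⟨cut_mono Subset.rfl (hν k.lt_succ_self).le,
      fun h => ?_⟩
    have hmem : {l (ν k)} ∈ cut T (ν (k + 1)) := ⟨hlT _, fun x hx => by
      rw [Finset.mem_singleton.1 hx, hνs]
      exact hlt _⟩
    exact absurd ((h hmem).2 _ (Finset.mem_singleton_self _)) (hle _).not_gt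
  · exact fun k A _ => Finset.filter_subset _ _
  · rintro k m hkm A _ A' _ rfl
    ext i
    simp only [Finset.mem_filter, Finset.mem_range, Finset.mem_inter]
    constructor
    · rintro ⟨hi, S, hS, hST, hc, hiS⟩
      exact ⟨⟨hi.trans hkm, S, hS, hST, fun a ha => (hc ha).1, hiS⟩, hi⟩
    · rintro ⟨⟨_, S, hS, hST, hc, hiS⟩, hi⟩
      exact ⟨hi, S, hS, hST, fun a ha => ⟨hc ha, fun x hx =>
        (ha.2 x hx).trans_le (hν.monotone hi)⟩, hiS⟩
  · intro k m hkm A _ A' _ hAA' i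
    simp only [Finset.mem_filter, Finset.mem_range]
    rintro ⟨hi, S, hS, hST, hc, hiS⟩
    exact ⟨hi.trans_le hkm, S, hS, hST, hc.trans hAA', hiS⟩
  · intro S hS hST
    ext i
    simp only [mem_iUnion, Finset.coe_filter, Finset.mem_range, mem_ofPred_eq]
    constructor
    · exact fun hi => ⟨i + 1, i.lt_succ_self, S, hS, hST, Subset.rfl, hi⟩
    · rintro ⟨k, hik, S', hS', hS'T, hc, hi⟩
      exact hTN (ν (i + 1)) (hνN _) i (hν.le_apply (x := i + 1)) S S' hS hS' hS'T
        (fun a ha => ⟨(hc ha).1, ha.2⟩) hi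

/-! ### Trees on flat-top fronts. -/

theorem IsFlatTopFront.nonempty_of_mem (hB : IsFlatTopFront B) {b : Finset ℕ} (hb : b ∈ B) :
    b.Nonempty := by
  rw [Finset.nonempty_iff_ne_empty]
  rintro rfl
  rcases hB.2.2 with h | h
  · simp [h] at hb
  · simpa using h.1 ∅ hb

theorem IsFlatTopFront.empty_mem_hatMinus (hB : IsFlatTopFront B) : ∅ ∈ hatMinus B := by
  obtain ⟨b, hb, -⟩ := hB.1.2.2.2 univ Subset.rfl infinite_univ
  refine ⟨b, hb, initSeg_empty _, fun h => (hB.nonempty_of_mem hb).ne_empty ?_⟩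
  exact (Finset.coe_injective h).symm

theorem IsFlatTopFront.exists_ultrafilter (hB : IsFlatTopFront B)
    (hU : ∀ c ∈ hatMinus B, IsPPoint (U c)) :
    ∃ W : Ultrafilter B, IsGeneratedByTrees B U W ∧ HasBasicTukeyReductions B U W := by
  obtain ⟨W, hW⟩ := exists_isGeneratedByTrees hB.1 hU (hatMinus_subset_hat hB.empty_mem_hatMinus)
  exact ⟨W, hW, hasBasicTukeyReductions hB.1 hU hB.empty_mem_hatMinus hW⟩

end Reductions

/-! ### Fronts and trees for Fubini products -/

/-- The finite set `{n} ∪ (t + (n + 1))`. -/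
def graft (n : ℕ) (t : Finset ℕ) : Finset ℕ :=
  insert n (t.map (addRightEmbedding (n + 1)))

theorem mem_graft {n x : ℕ} {t : Finset ℕ} :
    x ∈ graft n t ↔ x = n ∨ ∃ y ∈ t, y + (n + 1) = x := by
  simp [graft]

theorem self_mem_graft (n : ℕ) (t : Finset ℕ) : n ∈ graft n t :=
  Finset.mem_insert_self _ _

theorem add_mem_graft {n y : ℕ} {t : Finset ℕ} : y + (n + 1) ∈ graft n t ↔ y ∈ t := by
  rw [mem_graft]
  constructor
  · rintro (h | ⟨z, hz, h⟩)
    · omega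
    · rwa [← Nat.add_right_cancel h]
  · exact fun h => Or.inr ⟨y, h, rfl⟩

theorem le_of_mem_graft {n x : ℕ} {t : Finset ℕ} (hx : x ∈ graft n t) : n ≤ x := by
  rcases mem_graft.1 hx with rfl | ⟨y, _, rfl⟩ <;> omega

theorem graft_inj {n m : ℕ} {s t : Finset ℕ} : graft n s = graft m t ↔ n = m ∧ s = t := by
  refine ⟨fun h => ?_, by rintro ⟨rfl, rfl⟩; rfl⟩
  obtain rfl : n = m := (le_of_mem_graft (h ▸ self_mem_graft m t)).antisymm
    (le_of_mem_graft (h ▸ self_mem_graft n s))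
  exact ⟨rfl, Finset.ext fun y => by rw [← add_mem_graft (n := n), h, add_mem_graft]⟩

theorem graft_ne_empty (n : ℕ) (t : Finset ℕ) : graft n t ≠ ∅ :=
  Finset.insert_ne_empty _ _

theorem card_graft (n : ℕ) (t : Finset ℕ) : (graft n t).card = t.card + 1 := by
  rw [graft, Finset.card_insert_of_notMem, Finset.card_map]
  simp only [Finset.mem_map, addRightEmbedding_apply, not_exists, not_and]
  omega

theorem insert_graft (n l : ℕ) (t : Finset ℕ) :
    insert (l + (n + 1)) (graft n t) = graft n (insert l t) := by
  simp [graft, Finset.insert_comm]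

/-- The shift by `n + 1` lets any finite set follow `n`. The set `X` is arbitrary because the front
property of the sum needs infinite `X`. -/
theorem initSeg_graft_iff {n : ℕ} {t : Finset ℕ} {X : Set ℕ} :
    InitSeg (graft n t : Set ℕ) X ↔
      n ∈ X ∧ (∀ x ∈ X, n ≤ x) ∧ InitSeg (t : Set ℕ) {y | y + (n + 1) ∈ X} := by
  constructor
  · intro h
    refine ⟨h.1 (self_mem_graft n t), fun x hx => ?_, fun y hy =>
      h.1 (Finset.mem_coe.2 (add_mem_graft.2 hy)), fun x hx hxt y hy => ?_⟩
    · by_cases hxt : x ∈ graft n t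
      · exact le_of_mem_graft hxt
      · exact (h.2 x hx hxt n (self_mem_graft n t)).le
    · have := h.2 (x + (n + 1)) hx (fun h => hxt (add_mem_graft.1 h)) (y + (n + 1))
        (add_mem_graft.2 hy)
      omega
  · rintro ⟨hn, hle, h⟩
    refine ⟨fun x hx => ?_, fun x hx hxt y hy => ?_⟩
    · rcases mem_graft.1 hx with rfl | ⟨y, hy, rfl⟩
      · exact hn
      · exact h.1 hy
    · have hxn : x ≠ n := fun h => hxt (h ▸ self_mem_graft n t)
      obtain ⟨z, rfl⟩ : ∃ z, x = z + (n + 1) := ⟨x - (n + 1), by have := hle x hx; omega⟩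
      rcases mem_graft.1 hy with rfl | ⟨w, hw, rfl⟩
      · omega
      · have := h.2 z hx (fun h => hxt (add_mem_graft.2 h)) w hw
        omega

theorem initSeg_graft_graft {n m : ℕ} {s t : Finset ℕ} :
    InitSeg (graft n s : Set ℕ) (graft m t) ↔ n = m ∧ InitSeg (s : Set ℕ) t := by
  have key : ∀ n, {y | y + (n + 1) ∈ (graft n t : Set ℕ)} = t := fun n => by
    ext y
    exact add_mem_graft
  constructor
  · intro h
    obtain ⟨hn, hle, h⟩ := initSeg_graft_iff.1 h
    obtain rfl : n = m := (hle m (self_mem_graft m t)).antisymm (le_of_mem_graft hn)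
    exact ⟨rfl, key n ▸ h⟩
  · rintro ⟨rfl, h⟩
    exact initSeg_graft_iff.2 ⟨self_mem_graft n t, fun x hx => le_of_mem_graft hx,
      (key n).symm ▸ h⟩

theorem properInitSeg_graft_graft {n m : ℕ} {s t : Finset ℕ} :
    ProperInitSeg (graft n s : Set ℕ) (graft m t) ↔ n = m ∧ ProperInitSeg (s : Set ℕ) t := by
  simp only [ProperInitSeg, initSeg_graft_graft, ne_eq, Finset.coe_inj, graft_inj]
  tauto

theorem eq_empty_or_of_initSeg_graft {n : ℕ} {s t : Finset ℕ}
    (h : InitSeg (s : Set ℕ) (graft n t)) :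
    s = ∅ ∨ ∃ r : Finset ℕ, s = graft n r ∧ InitSeg (r : Set ℕ) t := by
  rcases s.eq_empty_or_nonempty with rfl | ⟨x, hx⟩
  · exact Or.inl rfl
  right
  have hn : n ∈ s := by
    by_contra hns
    exact (le_of_mem_graft (h.1 hx)).not_gt (h.2 n (self_mem_graft n t) hns x hx)
  have hs : s = graft n (s.preimage (· + (n + 1)) (add_left_injective (n + 1)).injOn) := by
    ext y
    rw [mem_graft]
    constructor
    · intro hy
      rcases mem_graft.1 (Finset.mem_coe.1 (h.1 hy)) with rfl | ⟨z, _, rfl⟩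
      · exact Or.inl rfl
      · exact Or.inr ⟨z, by simpa using hy, rfl⟩
    · rintro (rfl | ⟨z, hz, rfl⟩)
      · exact hn
      · simpa using hz
  refine ⟨_, hs, ?_⟩
  rw [hs] at h
  exact (initSeg_graft_graft.1 h).2

/-- The front whose members with minimum `n` come from the front `C n`. -/
def sumFront (C : ℕ → Set (Finset ℕ)) : Set (Finset ℕ) :=
  {b | ∃ n, ∃ c ∈ C n, b = graft n c}

section SumFront

variable {C : ℕ → Set (Finset ℕ)}

theorem graft_mem_sumFront {n : ℕ} {c : Finset ℕ} : graft n c ∈ sumFront C ↔ c ∈ C n := by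
  constructor
  · rintro ⟨m, c', hc', h⟩
    obtain ⟨rfl, rfl⟩ := graft_inj.1 h
    exact hc'
  · exact fun h => ⟨n, c, h, rfl⟩

theorem graft_mem_hat_sumFront {n : ℕ} {c : Finset ℕ} :
    graft n c ∈ hat (sumFront C) ↔ c ∈ hat (C n) := by
  constructor
  · rintro ⟨_, ⟨m, b, hb, rfl⟩, h⟩
    obtain ⟨rfl, h'⟩ := initSeg_graft_graft.1 h
    exact ⟨b, hb, h'⟩
  · rintro ⟨b, hb, h⟩
    exact ⟨_, graft_mem_sumFront.2 hb, initSeg_graft_graft.2 ⟨rfl, h⟩⟩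

theorem graft_mem_hatMinus_sumFront {n : ℕ} {c : Finset ℕ} :
    graft n c ∈ hatMinus (sumFront C) ↔ c ∈ hatMinus (C n) := by
  constructor
  · rintro ⟨_, ⟨m, b, hb, rfl⟩, h⟩
    obtain ⟨rfl, h'⟩ := properInitSeg_graft_graft.1 h
    exact ⟨b, hb, h'⟩
  · rintro ⟨b, hb, h⟩
    exact ⟨_, graft_mem_sumFront.2 hb, properInitSeg_graft_graft.2 ⟨rfl, h⟩⟩

theorem eq_empty_or_of_mem_hatMinus_sumFront {s : Finset ℕ} (hs : s ∈ hatMinus (sumFront C)) :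
    s = ∅ ∨ ∃ n, ∃ c ∈ hatMinus (C n), s = graft n c := by
  obtain ⟨_, ⟨n, b, hb, rfl⟩, h⟩ := hs
  rcases eq_empty_or_of_initSeg_graft h.1 with h0 | ⟨r, rfl, hr⟩
  · exact Or.inl h0
  · exact Or.inr ⟨n, r, ⟨b, hb, (properInitSeg_graft_graft.1 h).2⟩, rfl⟩

theorem IsFront.sumFront (hC : ∀ n, IsFront univ (C n)) : IsFront univ (sumFront C) := by
  refine ⟨infinite_univ, fun _ _ => subset_univ _, ?_, fun X _ hX => ?_⟩
  · rintro _ ⟨n, a, ha, rfl⟩ _ ⟨m, b, hb, rfl⟩ h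
    obtain ⟨rfl, h'⟩ := properInitSeg_graft_graft.1 h
    exact (hC n).2.2.1 a ha b hb h'
  · have hn : sInf X ∈ X := Nat.sInf_mem hX.nonempty
    -- Removing the minimum of `X` and shifting back leaves an infinite set, to which the front at
    -- that minimum applies.
    have hX' : {y | y + (sInf X + 1) ∈ X}.Infinite := by
      intro hfin
      refine hX (((hfin.image (· + (sInf X + 1))).union (finite_Iic (sInf X))).subset
        fun x hx => ?_)
      rcases le_or_gt x (sInf X) with h | h
      · exact Or.inr h
      · exact Or.inl ⟨x - (sInf X + 1), by simpa [Nat.sub_add_cancel h] using hx,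
          Nat.sub_add_cancel h⟩
    obtain ⟨b, hb, h⟩ := (hC (sInf X)).2.2.2 _ (subset_univ _) hX'
    refine ⟨_, graft_mem_sumFront.2 hb, initSeg_graft_iff.2 ⟨hn, fun x hx => Nat.sInf_le hx, h.1⟩,
      fun e => hX (e ▸ Finset.finite_toSet _)⟩

/-- In a flat-top front, the members extending `b \ {max b}` are its one-point end-extensions. -/
theorem IsFlatTopFront.extensions {B : Set (Finset ℕ)} (hB : IsFlatTopFront B) {a : Finset ℕ}
    {m : ℕ} (ham : ∀ x ∈ a, x < m) (hm : insert m a ∈ B) (c : Finset ℕ) :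
    c ∈ B ∧ ProperInitSeg (a : Set ℕ) c ↔ ∃ l, (∀ x ∈ a, x < l) ∧ c = insert l a := by
  have hproper : ∀ l, (∀ x ∈ a, x < l) → insert l a \ a = {l} := fun l hl => by
    rw [Finset.insert_sdiff_of_notMem _ fun h => lt_irrefl _ (hl l h)]
    simp
  rcases hB.2.2 with h | ⟨_, h⟩
  · have hcard : ∀ {b}, b ∈ B ↔ b.card = 1 := by simp [h]
    have ha : a = ∅ := by
      have := hcard.1 hm
      rw [Finset.card_insert_of_notMem fun h => lt_irrefl _ (ham m h)] at this
      exact Finset.card_eq_zero.1 (by omega)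
    subst ha
    constructor
    · rintro ⟨hc, -⟩
      obtain ⟨l, rfl⟩ := Finset.card_eq_one.1 (hcard.1 hc)
      exact ⟨l, by simp, by simp⟩
    · rintro ⟨l, hl, rfl⟩
      exact ⟨hcard.2 (by simp), properInitSeg_insert hl⟩
  · have hset := h a m ham hm
    constructor
    · rintro ⟨hc, hac⟩
      have : c \ a ∈ {d : Finset ℕ | ∃ l : ℕ, (∀ x ∈ a, x < l) ∧ d = {l}} :=
        hset ▸ ⟨c, hc, hac, rfl⟩
      obtain ⟨l, hl, hd⟩ := this
      refine ⟨l, hl, ?_⟩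
      rw [← Finset.sdiff_union_of_subset (Finset.coe_subset.1 hac.1.1), hd]
      rfl
    · rintro ⟨l, hl, rfl⟩
      refine ⟨?_, properInitSeg_insert hl⟩
      have : ({l} : Finset ℕ) ∈ {d : Finset ℕ | ∃ c ∈ B, ProperInitSeg (a : Set ℕ) c ∧ d = c \ a} :=
        hset ▸ ⟨l, hl, rfl⟩
      obtain ⟨c, hc, hac, hd⟩ := this
      have hca : c = insert l a := by
        rw [← Finset.sdiff_union_of_subset (Finset.coe_subset.1 hac.1.1), ← hd]
        rfl
      exact hca ▸ hc

/-- Members of each `C n` are nonempty, so grafting gives at least two elements and the second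
alternative applies. `IsFlatTopFront.extensions` treats both alternatives for `C n` at once. -/
theorem IsFlatTopFront.sumFront (hC : ∀ n, IsFlatTopFront (C n)) :
    IsFlatTopFront (sumFront C) := by
  have hcard : ∀ b ∈ FubiniTukey.sumFront C, 2 ≤ b.card := by
    rintro _ ⟨n, c, hc, rfl⟩
    have := ((hC n).nonempty_of_mem hc).card_pos
    rw [card_graft]
    omega
  have hfront := IsFront.sumFront fun n => (hC n).1
  obtain ⟨b₀, hb₀, -⟩ := hfront.2.2.2 univ Subset.rfl infinite_univ
  refine ⟨hfront, fun h => ?_, Or.inr ⟨hcard, fun a m ham hm => ?_⟩⟩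
  · have h1 := hcard b₀ hb₀
    have h2 : b₀ = ∅ := by rwa [h] at hb₀
    simp [h2] at h1
  obtain ⟨n, b, hb, hbe⟩ := hm
  rcases eq_empty_or_of_initSeg_graft (hbe ▸ initSeg_insert ham) with rfl | ⟨a, rfl, -⟩
  · have := hcard _ (graft_mem_sumFront.2 hb)
    simp [← hbe] at this
  have hshift : ∀ l, (∀ x ∈ graft n a, x < l) ↔ ∃ k, (∀ x ∈ a, x < k) ∧ l = k + (n + 1) := by
    intro l
    constructor
    · intro h
      have hnl := h n (self_mem_graft n a)
      refine ⟨l - (n + 1), fun x hx => ?_, by omega⟩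
      have := h _ (add_mem_graft.2 hx)
      omega
    · rintro ⟨k, hk, rfl⟩ x hx
      rcases mem_graft.1 hx with rfl | ⟨y, hy, rfl⟩
      · omega
      · have := hk y hy
        omega
  have hsdiff : ∀ k, (∀ x ∈ a, x < k) → graft n (insert k a) \ graft n a = {k + (n + 1)} := by
    intro k hk
    rw [← insert_graft, Finset.insert_sdiff_of_notMem _ fun h => lt_irrefl _
      (hk k (add_mem_graft.1 h))]
    simp
  obtain ⟨m, ham', rfl⟩ := (hshift m).1 ham
  rw [insert_graft, graft_inj] at hbe
  have hext := (hC n).extensions ham' (hbe.2 ▸ hb)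
  ext d
  simp only [mem_ofPred_eq, hshift]
  constructor
  · rintro ⟨_, ⟨n', c, hc, rfl⟩, hac, rfl⟩
    obtain ⟨rfl, hac'⟩ := properInitSeg_graft_graft.1 hac
    obtain ⟨k, hk, rfl⟩ := (hext c).1 ⟨hc, hac'⟩
    exact ⟨_, ⟨k, hk, rfl⟩, hsdiff k hk⟩
  · rintro ⟨_, ⟨k, hk, rfl⟩, rfl⟩
    obtain ⟨hc, hac⟩ := (hext _).2 ⟨k, hk, rfl⟩
    exact ⟨_, graft_mem_sumFront.2 hc, properInitSeg_graft_graft.2 ⟨rfl, hac⟩, (hsdiff k hk).symm⟩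

end SumFront

/-! ### P-points and trees on a sum of fronts. -/

theorem IsPPoint.map_of_injective {V : Ultrafilter ℕ} (hV : IsPPoint V) {g : ℕ → ℕ}
    (hg : Function.Injective g) : IsPPoint (V.map g) := by
  refine ⟨fun n hn => ?_, fun X hX hXV => ?_⟩
  · refine hV.finite_notMem ((finite_singleton n).preimage hg.injOn) ?_
    have : ({n} : Set ℕ) ∈ V.map g := hn ▸ Ultrafilter.mem_pure.2 rfl
    exact Ultrafilter.mem_map.1 this
  · obtain ⟨Y, hY, hfin⟩ := hV.2 (fun n => g ⁻¹' X n) (fun m n h => preimage_mono (hX h)) hXV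
    refine ⟨g '' Y, Ultrafilter.mem_map.2 (Filter.mem_of_superset hY (subset_preimage_image _ _)),
      fun n => ((hfin n).image g).subset ?_⟩
    rintro _ ⟨⟨y, hy, rfl⟩, hyX⟩
    exact ⟨y, ⟨hy, hyX⟩, rfl⟩

open Classical in
/-- The ultrafilters at the nodes of `sumFront C`: `U` at the root, and above `{n}` the shifted
ultrafilters of `Us n`. -/
noncomputable def sumUltrafilter (U : Ultrafilter ℕ) (Us : ℕ → Finset ℕ → Ultrafilter ℕ) (s : Finset ℕ) :
    Ultrafilter ℕ :=
  if h : ∃ p : ℕ × Finset ℕ, s = graft p.1 p.2 then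
    (Us h.choose.1 h.choose.2).map (· + (h.choose.1 + 1)) else U

section SumUltrafilter

variable {C : ℕ → Set (Finset ℕ)} {U : Ultrafilter ℕ} {Us : ℕ → Finset ℕ → Ultrafilter ℕ}

theorem sumUltrafilter_empty : sumUltrafilter U Us ∅ = U :=
  dif_neg fun ⟨_, hp⟩ => graft_ne_empty _ _ hp.symm

theorem sumUltrafilter_graft (n : ℕ) (c : Finset ℕ) :
    sumUltrafilter U Us (graft n c) = (Us n c).map (· + (n + 1)) := by
  have h : ∃ p : ℕ × Finset ℕ, graft n c = graft p.1 p.2 := ⟨(n, c), rfl⟩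
  obtain ⟨h1, h2⟩ := graft_inj.1 h.choose_spec
  rw [sumUltrafilter, dif_pos h, ← h1, ← h2]

theorem isPPoint_sumUltrafilter (hU : IsPPoint U)
    (hUs : ∀ n, ∀ c ∈ hatMinus (C n), IsPPoint (Us n c)) :
    ∀ s ∈ hatMinus (sumFront C), IsPPoint (sumUltrafilter U Us s) := by
  intro s hs
  rcases eq_empty_or_of_mem_hatMinus_sumFront hs with rfl | ⟨n, c, hc, rfl⟩
  · rwa [sumUltrafilter_empty]
  · rw [sumUltrafilter_graft]
    exact (hUs n c hc).map_of_injective (add_left_injective _)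

theorem IsUTree.section_graft {T : Set (Finset ℕ)}
    (hT : IsUTree (sumFront C) (sumUltrafilter U Us) T) {n : ℕ} (hn : {n} ∈ T) :
    IsUTree (C n) (Us n) {t | graft n t ∈ T} := by
  refine ⟨fun t ht => graft_mem_hat_sumFront.1 (hT.1 ht), fun t ht s hs =>
    hT.2.1 _ ht _ (initSeg_graft_graft.2 ⟨rfl, hs⟩), by simpa [graft] using hn, fun c hc => ?_⟩
  have h := hT.2.2.2 (graft n c) ⟨hc.1, graft_mem_hatMinus_sumFront.2 hc.2⟩
  rw [sumUltrafilter_graft, Ultrafilter.mem_map] at h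
  simpa [insert_graft, preimage] using h

/-- The base set of the Fubini product is in bijection with the sum of the fronts. -/
noncomputable def sumFrontEquiv {α : ℕ → Type} (e : ∀ n, α n ≃ C n) : (Σ n, α n) ≃ sumFront C :=
  Equiv.ofBijective
    (fun p => ⟨graft p.1 (e p.1 p.2), graft_mem_sumFront.2 (e p.1 p.2).2⟩) <| by
    constructor
    · rintro ⟨n, x⟩ ⟨m, y⟩ h
      obtain ⟨hnm, hxy⟩ := graft_inj.1 (Subtype.ext_iff.1 h)
      dsimp only at hnm hxy
      subst hnm
      rw [(e n).injective (Subtype.ext hxy)]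
    · rintro ⟨_, n, c, hc, rfl⟩
      exact ⟨⟨n, (e n).symm ⟨c, hc⟩⟩, by simp⟩

/-- Comparable ultrafilters are equal, so it suffices that each `[T]` is large for the product: the
root gives `U`-many `n`, and for each of these the section of `T` above `{n}` is a tree on `C n`. -/
theorem map_fubiniLim_eq {α : ℕ → Type} {V : ∀ n, Ultrafilter (α n)} {W : ∀ n, Ultrafilter (C n)}
    {e : ∀ n, α n ≃ C n} (he : ∀ n, (V n).map (e n) = W n) (hC : ∀ n, IsFlatTopFront (C n))
    (hW : ∀ n, IsGeneratedByTrees (C n) (Us n) (W n)) {W' : Ultrafilter (sumFront C)}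
    (hW' : IsGeneratedByTrees (sumFront C) (sumUltrafilter U Us) W') :
    (fubiniLim U V).map (sumFrontEquiv e) = W' := by
  refine Ultrafilter.eq_of_le ((hW'.ge_iff).2 fun T hT => ?_)
  have hfront := IsFlatTopFront.sumFront hC
  have h := hT.2.2.2 ∅ ⟨hT.2.2.1, hfront.empty_mem_hatMinus⟩
  rw [sumUltrafilter_empty] at h
  refine (mem_fubiniLim U V _).2 ?_
  filter_upwards [h] with n hn
  have hTn := hT.section_graft (n := n) (by simpa using hn)
  have hmem := branches_mem (hW n) hTn
  rw [← he n, Ultrafilter.mem_map] at hmem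
  filter_upwards [hmem] with x hx
  exact (hfront.1.mem_branches hT.1 _).2 hx.1

end SumUltrafilter

/-! ### Iterated Fubini products -/

theorem isFlatTopFront_singletons : IsFlatTopFront {b | b.card = 1} := by
  refine ⟨⟨infinite_univ, fun _ _ => subset_univ _, fun a ha b hb h => ?_, fun X _ hX => ?_⟩,
    fun h => ?_, Or.inl rfl⟩
  · refine h.2 (congrArg _ (Finset.eq_of_subset_of_card_le (Finset.coe_subset.1 h.1.1) ?_))
    rw [mem_ofPred_eq] at ha hb
    omega
  · refine ⟨{sInf X}, by simp, ⟨by simpa using Nat.sInf_mem hX.nonempty, fun x hx hxn y hy => ?_⟩,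
      fun h => hX (h ▸ Finset.finite_toSet _)⟩
    simp only [Finset.coe_singleton, mem_singleton_iff] at hxn hy
    exact hy ▸ lt_of_le_of_ne (Nat.sInf_le hx) (Ne.symm hxn)
  · have : ({0} : Finset ℕ) ∈ ({∅} : Set (Finset ℕ)) := h ▸ by simp
    simp at this

/-- The natural numbers as the front of singletons. -/
noncomputable def singletonEquiv : ℕ ≃ {b : Finset ℕ | b.card = 1} :=
  Equiv.ofBijective (fun n => ⟨{n}, by simp⟩)
    ⟨fun n m h => by simpa using h, fun ⟨b, hb⟩ => by
      obtain ⟨n, rfl⟩ := Finset.card_eq_one.1 hb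
      exact ⟨n, rfl⟩⟩

/-- A p-point lives on the front of singletons, where only the root carries an ultrafilter; a Fubini
limit lives on the sum of the fronts of its factors; a bijection only changes the identification. -/
theorem IsFubiniIterate.exists_front {α : Type} {X : Ultrafilter α} (hX : IsFubiniIterate α X) :
    ∃ (B : Set (Finset ℕ)) (U : Finset ℕ → Ultrafilter ℕ) (W : Ultrafilter B),
      IsFlatTopFront B ∧ (∀ c ∈ hatMinus B, IsPPoint (U c)) ∧ IsGeneratedByTrees B U W ∧
        ∃ e : α ≃ B, X.map e = W := by
  induction hX with
  | pPoint U hU =>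
    have hB := isFlatTopFront_singletons
    obtain ⟨W, hW, -⟩ := hB.exists_ultrafilter (U := fun _ => U) fun _ _ => hU
    refine ⟨_, _, W, hB, fun _ _ => hU, hW, singletonEquiv,
      Ultrafilter.eq_of_le ((hW.ge_iff).2 fun T hT => ?_)⟩
    refine Ultrafilter.mem_map.2 ?_
    filter_upwards [hT.2.2.2 ∅ ⟨hT.2.2.1, hB.empty_mem_hatMinus⟩] with n hn
    exact (hB.1.mem_branches hT.1 _).2 hn
  | lim U α V hU _ ih =>
    choose C Us W hC hUs hW e he using ih
    have hB := IsFlatTopFront.sumFront hC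
    have hP := isPPoint_sumUltrafilter hU hUs
    obtain ⟨W', hW', -⟩ := hB.exists_ultrafilter hP
    exact ⟨_, _, W', hB, hP, hW', sumFrontEquiv e, map_fubiniLim_eq he hC hW hW'⟩
  | equiv α β e X _ ih =>
    obtain ⟨B, U, W, hB, hU, hW, e', he'⟩ := ih
    refine ⟨B, U, W, hB, hU, hW, e.symm.trans e', ?_⟩
    rw [← he', Ultrafilter.map_map]
    congr 1
    ext x
    simp

end FubiniTukey

theorem theorem4p4 :
    (∀ (B : Set (Finset ℕ)) (U : Finset ℕ → Ultrafilter ℕ),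
      FubiniTukey.IsFlatTopFront B →
      (∀ c ∈ FubiniTukey.hatMinus B, FubiniTukey.IsPPoint (U c)) →
      ∃ W : Ultrafilter B, FubiniTukey.IsGeneratedByTrees B U W ∧
        FubiniTukey.HasBasicTukeyReductions B U W) ∧
    (∀ (α : Type) (X : Ultrafilter α), FubiniTukey.IsFubiniIterate α X →
      ∃ (B : Set (Finset ℕ)) (U : Finset ℕ → Ultrafilter ℕ) (W : Ultrafilter B),
        FubiniTukey.IsFlatTopFront B ∧
        (∀ c ∈ FubiniTukey.hatMinus B, FubiniTukey.IsPPoint (U c)) ∧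
        FubiniTukey.IsGeneratedByTrees B U W ∧
        (∃ e : α ≃ B, X.map e = W) ∧
        FubiniTukey.HasBasicTukeyReductions B U W) := by
  refine ⟨fun B U hB hU => hB.exists_ultrafilter hU, fun α X hX => ?_⟩
  obtain ⟨B, U, W, hB, hU, hW, he⟩ := hX.exists_front
  exact ⟨B, U, W, hB, hU, hW, he,
    FubiniTukey.hasBasicTukeyReductions hB.1 hU hB.empty_mem_hatMinus hW⟩
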